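/- Let $K$ be a field, let $E$ be an elliptic curve over $K$ (given by a Weierstrass equation), and let $L/K$ be a finite field extension of inseparable degree $[L:K]_{\mathrm{ins}}$. For $P \in E(L)$, the trace $\operatorname{Tr}^L_K P$ is the unique point $T \in E(K)$ such that, for every algebraically closed field $\Omega$ and every embedding $i : K \hookrightarrow \Omega$, $$T^{i} = [L:K]_{\mathrm{ins}} \sum_{j \in \operatorname{Hom}_i(L,\Omega)} P^{j},$$ where $j$ ranges over the embeddings of $L$ into $\Omega$ that extend $i$, and $T^i$, $P^j$ denote the images of $T$, $P$ under $i$, $j$ in the group of $\Omega$-points of the curve $E$ base-changed along $i$. This trace is well defined: the point $T$ exists, is already determined by the equation for any single pair $(\Omega, i)$, and does not depend on that pair. Let $K \subseteq L \subseteq M$ be a tower of finite field extensions and let $P \in E(L)$, viewed also as a point of $E(M)$. Then $$\operatorname{Tr}^M_K P = [M:L]\,\operatorname{Tr}^L_K P \quad \text{in } E(K).$$ -/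

import Mathlib

open scoped Classical
open WeierstrassCurve WeierstrassCurve.Affine

/-- The relation "`T` is the trace of `P` relative to `L/K` and to the embedding `i : K → Ω`".
The embedding `i` is the one given by the `K`-algebra structure of `Ω`, so that the embeddings of
`L` into `Ω` which extend `i` are the `K`-algebra homomorphisms `j : L →ₐ[K] Ω`. The condition is
`T^i = [L:K]_ins ∑_j P^j` in the group `E(Ω)`. -/
def IsPointTrace {K : Type*} [Field K] (E : WeierstrassCurve K) {L : Type*} [Field L] [Algebra K L]
    [FiniteDimensional K L] (Ω : Type*) [Field Ω] [Algebra K Ω]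
    (P : (E.toAffine⁄L).Point) (T : (E.toAffine⁄K).Point) : Prop :=
  Point.map (W' := E.toAffine) (Algebra.ofId K Ω) T =
    Field.finInsepDegree K L • ∑ j : L →ₐ[K] Ω, Point.map (W' := E.toAffine) j P

/-- The trace `Tr(L/K, i, P)`: the point `T ∈ E(K)` such that `T^i = [L:K]_ins ∑_j P^j`
(the embedding `i : K → Ω` is the structure map of the `K`-algebra `Ω`). -/
noncomputable def pointTraceRel {K : Type*} [Field K] (E : WeierstrassCurve K) {L : Type*} [Field L]
    [Algebra K L] [FiniteDimensional K L] (Ω : Type*) [Field Ω] [Algebra K Ω]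
    (P : (E.toAffine⁄L).Point) : (E.toAffine⁄K).Point :=
  Classical.epsilon fun T => IsPointTrace E Ω P T

/-- The trace `Tr^L_K P`, computed in the standard algebraic closure of `K`. -/
noncomputable def pointTrace {K : Type*} [Field K] (E : WeierstrassCurve K) {L : Type*} [Field L]
    [Algebra K L] [FiniteDimensional K L] (P : (E.toAffine⁄L).Point) : (E.toAffine⁄K).Point :=
  pointTraceRel E (AlgebraicClosure K) P

/-! The trace exists for two reasons. For L/F purely inseparable, [L:F] carries E(L) into E(F): the
invariant differential is translation invariant, so pulling it back along a point and evaluating at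
a derivation `D` is additive (`IsLogDeriv.add`); a multiple by n = 0 in L gets value 0, so its
coordinates are constants of `D`, and one inducts on the degree (`exists_map_eq_finrank_nsmul`). For
F/K separable, the sum of conjugates descends by Galois theory. The tower formula then counts
embeddings: each embedding of L has [M:L]_s extensions to M, and inseparable degrees multiply. -/

namespace WeierstrassCurve.Affine.Point

/-! ### Additivity of the logarithmic derivative -/

variable {R F : Type*} [CommRing R] [Field F] [Algebra R F] {W : Affine F}

/-- `t` is the value at `D` of the pullback of the invariant differential
`dx / (2y + a₁x + a₃) = dy / (3x² + 2a₂x + a₄ - a₁y)` along the point `P`. -/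
def IsLogDeriv (D : Derivation R F F) (t : F) : W.Point → Prop
  | 0 => t = 0
  | some x y _ => D x = t * (2 * y + W.a₁ * x + W.a₃) ∧
      D y = t * (3 * x ^ 2 + 2 * W.a₂ * x + W.a₄ - W.a₁ * y)

/-- The coefficients of the Weierstrass equation are constants for the derivation `D`. -/
structure HasConstCoeffs (W : Affine F) (D : Derivation R F F) : Prop where
  a₁ : D W.a₁ = 0
  a₂ : D W.a₂ = 0
  a₃ : D W.a₃ = 0
  a₄ : D W.a₄ = 0
  a₆ : D W.a₆ = 0

variable {D : Derivation R F F}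

lemma derivation_equation (hD : HasConstCoeffs W D) {x y : F} (h : W.Equation x y) :
    (2 * y + W.a₁ * x + W.a₃) * D y = (3 * x ^ 2 + 2 * W.a₂ * x + W.a₄ - W.a₁ * y) * D x := by
  have := congr_arg D ((W.equation_iff x y).mp h)
  simp only [map_add, Derivation.leibniz, Derivation.leibniz_pow, smul_eq_mul, nsmul_eq_mul,
    hD.a₁, hD.a₂, hD.a₃, hD.a₄, hD.a₆] at this
  push_cast at this
  linear_combination this

lemma exists_isLogDeriv (hD : HasConstCoeffs W D) (P : W.Point) : ∃ t, IsLogDeriv D t P := by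
  match P with
  | 0 => exact ⟨0, rfl⟩
  | some x y h =>
    have hd := derivation_equation hD h.1
    by_cases hψ : 2 * y + W.a₁ * x + W.a₃ = 0
    -- Nonsingularity: the two denominators of the invariant differential cannot both vanish.
    · have hω : 3 * x ^ 2 + 2 * W.a₂ * x + W.a₄ - W.a₁ * y ≠ 0 := fun h0 ↦ by
        rcases ((W.nonsingular_iff x y).mp h).2 with h' | h'
        · exact h' (by linear_combination -h0)
        · exact h' (by linear_combination hψ)
      have hx : D x = 0 := by
        rw [hψ, zero_mul, eq_comm, mul_eq_zero] at hd
        exact hd.resolve_left hω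
      exact ⟨D y / (3 * x ^ 2 + 2 * W.a₂ * x + W.a₄ - W.a₁ * y), by rw [hψ, hx, mul_zero],
        (div_mul_cancel₀ _ hω).symm⟩
    · refine ⟨D x / (2 * y + W.a₁ * x + W.a₃), (div_mul_cancel₀ _ hψ).symm, ?_⟩
      field_simp
      linear_combination hd

/-- The chord and tangent cases share everything but the derivative of the slope. -/
lemma isLogDeriv_addXY (hD : HasConstCoeffs W D) {x₁ y₁ x₂ y₂ ℓ t₁ t₂ x₃ : F}
    (hx₃ : x₃ = W.addX x₁ x₂ ℓ)
    (hx₁ : D x₁ = t₁ * (2 * y₁ + W.a₁ * x₁ + W.a₃))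
    (hy₁ : D y₁ = t₁ * (3 * x₁ ^ 2 + 2 * W.a₂ * x₁ + W.a₄ - W.a₁ * y₁))
    (hx₂ : D x₂ = t₂ * (2 * y₂ + W.a₁ * x₂ + W.a₃))
    (hline : y₁ - y₂ = ℓ * (x₁ - x₂))
    (htangent : 3 * x₁ ^ 2 + 2 * W.a₂ * x₁ + W.a₄ - W.a₁ * y₁ -
      ℓ * (2 * y₁ + W.a₁ * x₁ + W.a₃) = (x₁ - x₂) * (x₁ - x₃))
    (hℓ : D ℓ = t₁ * (x₁ - x₃) + t₂ * (x₂ - x₃)) :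
    D x₃ = (t₁ + t₂) * (2 * W.addY x₁ x₂ y₁ ℓ + W.a₁ * x₃ + W.a₃) ∧
    D (W.addY x₁ x₂ y₁ ℓ) = (t₁ + t₂) *
      (3 * x₃ ^ 2 + 2 * W.a₂ * x₃ + W.a₄ - W.a₁ * W.addY x₁ x₂ y₁ ℓ) := by
  have hy₃ : W.addY x₁ x₂ y₁ ℓ = -(ℓ * (x₃ - x₁) + y₁) - W.a₁ * x₃ - W.a₃ := by
    rw [hx₃]; rfl
  have hDx₃ : D x₃ = (2 * ℓ + W.a₁) * D ℓ - D x₁ - D x₂ := by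
    rw [hx₃, addX]
    simp only [map_add, map_sub, Derivation.leibniz, Derivation.leibniz_pow, smul_eq_mul,
      nsmul_eq_mul, hD.a₁, hD.a₂]
    push_cast
    ring
  have hx₃' : D x₃ = (t₁ + t₂) * (2 * W.addY x₁ x₂ y₁ ℓ + W.a₁ * x₃ + W.a₃) := by
    rw [hDx₃, hℓ, hx₁, hx₂, hy₃]
    linear_combination 2 * t₂ * hline
  refine ⟨hx₃', ?_⟩
  have hDy₃ : D (W.addY x₁ x₂ y₁ ℓ) =
      -(D ℓ * (x₃ - x₁) + ℓ * (D x₃ - D x₁) + D y₁) - W.a₁ * D x₃ := by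
    rw [hy₃]
    simp only [map_add, map_sub, map_neg, Derivation.leibniz, smul_eq_mul, hD.a₁, hD.a₃]
    ring
  rw [hDy₃, hx₃', hℓ, hx₁, hy₁, hy₃]
  rw [addX] at hx₃
  linear_combination (-t₁ - (t₁ + t₂)) * htangent - 2 * (t₁ + t₂) * (x₃ - x₁) * hx₃

lemma IsLogDeriv.add (hD : HasConstCoeffs W D) {t₁ t₂ : F} {P Q : W.Point}
    (hP : IsLogDeriv D t₁ P) (hQ : IsLogDeriv D t₂ Q) : IsLogDeriv D (t₁ + t₂) (P + Q) := by
  match P, Q, hP, hQ with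
  | 0, Q, hP, hQ => rwa [show t₁ = 0 from hP, zero_add, zero_add]
  | some x y h, 0, hP, hQ => rwa [show t₂ = 0 from hQ, add_zero, add_zero]
  | some x₁ y₁ h₁, some x₂ y₂ h₂, ⟨hx₁, hy₁⟩, ⟨hx₂, hy₂⟩ =>
    have e₁ := (W.equation_iff x₁ y₁).mp h₁.1
    have e₂ := (W.equation_iff x₂ y₂).mp h₂.1
    by_cases hxy : x₁ = x₂ ∧ y₁ = W.negY x₂ y₂
    · obtain ⟨rfl, rfl⟩ := hxy
      rw [add_of_Y_eq rfl rfl]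
      change t₁ + t₂ = 0
      simp only [negY, map_sub, map_neg, Derivation.leibniz, smul_eq_mul, hD.a₁, hD.a₃] at hx₁ hy₁
      -- If t₁ + t₂ ≠ 0, both partial derivatives vanish at the point, contradicting nonsingularity.
      by_contra ht
      have hψ : 2 * y₂ + W.a₁ * x₁ + W.a₃ = 0 := by
        refine (mul_eq_zero.mp ?_).resolve_left ht
        linear_combination hx₁ - hx₂
      have hω : 3 * x₁ ^ 2 + 2 * W.a₂ * x₁ + W.a₄ - W.a₁ * y₂ = 0 := by
        refine (mul_eq_zero.mp ?_).resolve_left ht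
        linear_combination -hy₁ - hy₂ - W.a₁ * hx₁
      rcases ((W.nonsingular_iff x₁ y₂).mp h₂).2 with h' | h'
      · exact h' (by linear_combination -hω)
      · exact h' (by linear_combination hψ)
    · rw [add_some hxy]
      set ℓ := W.slope x₁ x₂ y₁ y₂ with hℓ
      by_cases hx : x₁ = x₂
      · have hy : y₁ ≠ W.negY x₂ y₂ := fun hy ↦ hxy ⟨hx, hy⟩
        obtain rfl := Y_eq_of_Y_ne h₁.1 h₂.1 hx hy
        subst hx
        have hψ : 2 * y₁ + W.a₁ * x₁ + W.a₃ ≠ 0 := fun h0 ↦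
          hy (by rw [negY]; linear_combination h0)
        obtain rfl : t₁ = t₂ := mul_right_cancel₀ hψ (hx₁.symm.trans hx₂)
        rw [slope_of_Y_ne rfl hy, eq_div_iff (sub_ne_zero.mpr hy), negY] at hℓ
        refine isLogDeriv_addXY hD rfl hx₁ hy₁ hx₂ (by ring) (by linear_combination -hℓ) ?_
        have two : D (2 : F) = 0 := mod_cast D.map_natCast 2
        have three : D (3 : F) = 0 := mod_cast D.map_natCast 3
        have hd := congr_arg D hℓ
        simp only [map_add, map_sub, map_neg, Derivation.leibniz, Derivation.leibniz_pow,
          smul_eq_mul, nsmul_eq_mul, hD.a₁, hD.a₂, hD.a₃, hD.a₄, two, three] at hd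
        push_cast at hd
        refine mul_right_cancel₀ hψ ?_
        rw [addX]
        linear_combination hd + (6 * x₁ + 2 * W.a₂ - W.a₁ * ℓ - ℓ * (2 * ℓ + W.a₁)) * hx₁ -
          (W.a₁ + 2 * ℓ) * (hy₁ - ℓ * hx₁ - t₁ * hℓ)
      · rw [slope_of_X_ne hx, eq_div_iff (sub_ne_zero.mpr hx)] at hℓ
        have hx' := sub_ne_zero.mpr hx
        have hG : ℓ * (y₁ + y₂) + W.a₁ * (y₁ + x₂ * ℓ) + W.a₃ * ℓ =
            x₁ ^ 2 + x₁ * x₂ + x₂ ^ 2 + W.a₂ * (x₁ + x₂) + W.a₄ := by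
          refine mul_right_cancel₀ hx' ?_
          linear_combination e₁ - e₂ + (y₁ + y₂ + W.a₁ * x₂ + W.a₃) * hℓ
        -- On the line, the cubic becomes (X - x₁)(X - x₂)(X - x₃); this is its derivative at x₁,
        -- and next at x₂.
        have hω₁ : 3 * x₁ ^ 2 + 2 * W.a₂ * x₁ + W.a₄ - W.a₁ * y₁ -
            ℓ * (2 * y₁ + W.a₁ * x₁ + W.a₃) = (x₁ - x₂) * (x₁ - W.addX x₁ x₂ ℓ) := by
          rw [addX]
          linear_combination -hG + ℓ * hℓ
        have hω₂ : 3 * x₂ ^ 2 + 2 * W.a₂ * x₂ + W.a₄ - W.a₁ * y₂ -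
            ℓ * (2 * y₂ + W.a₁ * x₂ + W.a₃) = (x₂ - x₁) * (x₂ - W.addX x₁ x₂ ℓ) := by
          rw [addX]
          linear_combination -hG - (ℓ + W.a₁) * hℓ
        refine isLogDeriv_addXY hD rfl hx₁ hy₁ hx₂ hℓ.symm hω₁ ?_
        have hd := congr_arg D hℓ
        simp only [map_sub, Derivation.leibniz, smul_eq_mul] at hd
        refine mul_right_cancel₀ hx' ?_
        linear_combination hd + t₁ * hω₁ - t₂ * hω₂ + hy₁ - hy₂ - ℓ * (hx₁ - hx₂)

lemma IsLogDeriv.nsmul (hD : HasConstCoeffs W D) {t : F} {P : W.Point} (hP : IsLogDeriv D t P)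
    (n : ℕ) : IsLogDeriv D (n * t) (n • P) := by
  induction n with
  | zero => rw [zero_nsmul, Nat.cast_zero, zero_mul]; exact (rfl : (0 : F) = 0)
  | succ n ih =>
    rw [succ_nsmul, Nat.cast_succ, add_mul, one_mul]
    exact ih.add hD hP

end WeierstrassCurve.Affine.Point

/-! ### Derivations and inseparability -/

/-- The constants of a derivation on a field, as an intermediate field. -/
def Derivation.constants {F L M : Type*} [Field F] [Field L] [Algebra F L] [AddCommGroup M]
    [Module F M] [Module L M] (D : Derivation F L M) : IntermediateField F L where
  carrier := {x | D x = 0}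
  mul_mem' {x y} hx hy := by
    rw [Set.mem_ofPred_eq] at hx hy ⊢
    rw [D.leibniz, hx, hy, smul_zero, smul_zero, add_zero]
  add_mem' {x y} hx hy := by
    rw [Set.mem_ofPred_eq] at hx hy ⊢
    rw [map_add, hx, hy, add_zero]
  algebraMap_mem' r := D.map_algebraMap r
  inv_mem' x hx := by
    change D x = 0 at hx
    change D x⁻¹ = 0
    rw [D.leibniz_inv, hx, smul_zero]

/-- A finite extension without nonzero derivations is separable. -/
lemma exists_derivation_constants_ne_top (F L : Type*) [Field F] [Field L] [Algebra F L]
    [FiniteDimensional F L] (h : ¬ Algebra.IsSeparable F L) :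
    ∃ D : Derivation F L L, D.constants ≠ ⊤ := by
  by_contra! hD
  refine h ((Algebra.FormallyUnramified.iff_isSeparable F L).mp ⟨?_⟩)
  suffices hd : ∀ x, KaehlerDifferential.D F L x = 0 by
    have := KaehlerDifferential.span_range_derivation F L
    rw [show Set.range (KaehlerDifferential.D F L) = {0} from
      Set.ext fun y ↦ ⟨fun ⟨x, hx⟩ ↦ hx ▸ hd x, fun hy ↦ ⟨0, by rw [map_zero, hy]⟩⟩,
      Submodule.span_zero_singleton] at this
    exact Submodule.subsingleton_iff L |>.mp (subsingleton_of_bot_eq_top this)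
  intro x
  -- A functional on the differentials composed with d is a derivation of L, hence zero by
  -- assumption.
  refine (Module.forall_dual_apply_eq_zero_iff L _).mp fun f ↦ ?_
  have hx : x ∈ (f.compDer (KaehlerDifferential.D F L)).constants := hD _ ▸ trivial
  exact hx

/-! ### Purely inseparable descent -/

namespace WeierstrassCurve.Affine.Point

variable {K : Type*} [Field K] (E : WeierstrassCurve K)

lemma exists_map_eq {A B : Type*} [Field A] [Field B] [Algebra K A] [Algebra K B] (f : A →ₐ[K] B)
    (P : (E.toAffine⁄B).Point) (h : ∀ x y hxy, P = some x y hxy → x ∈ f.range ∧ y ∈ f.range) :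
    ∃ Q : (E.toAffine⁄A).Point, Point.map (W' := E.toAffine) f Q = P := by
  match P with
  | 0 => exact ⟨0, rfl⟩
  | some x y hxy =>
    obtain ⟨⟨x, rfl⟩, ⟨y, rfl⟩⟩ := h x y hxy rfl
    exact ⟨some x y ((E.toAffine.baseChange_nonsingular f.injective ..).mp hxy), rfl⟩

lemma exists_map_constants {F L : Type*} [Field F] [Field L] [Algebra K F] [Algebra K L]
    [Algebra F L] [IsScalarTower K F L] (D : Derivation F L L) {n : ℕ} (hn : (n : L) = 0)
    (P : (E.toAffine⁄L).Point) :
    ∃ Q : (E.toAffine⁄D.constants).Point,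
      Point.map (W' := E.toAffine) (D.constants.val.restrictScalars K) Q = n • P := by
  have hK (a : K) : D (algebraMap K L a) = 0 := by
    rw [IsScalarTower.algebraMap_apply K F L, D.map_algebraMap]
  have hD : HasConstCoeffs (E.toAffine⁄L) D := ⟨hK _, hK _, hK _, hK _, hK _⟩
  obtain ⟨t, ht⟩ := exists_isLogDeriv hD P
  have hnP := ht.nsmul hD n
  rw [hn, zero_mul] at hnP
  refine exists_map_eq E _ _ fun x y hxy h ↦ ?_
  rw [h] at hnP
  exact ⟨⟨⟨x, hnP.1.trans (zero_mul _)⟩, rfl⟩, ⟨⟨y, hnP.2.trans (zero_mul _)⟩, rfl⟩⟩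

/-- If `L / F` is purely inseparable, multiplication by `[L : F]` maps `E(L)` to `E(F)`. -/
theorem exists_map_eq_finrank_nsmul {F : Type*} {L : Type*} [Field F] [Field L] [Algebra K F]
    [Algebra K L] [Algebra F L] [IsScalarTower K F L] [FiniteDimensional F L]
    [IsPurelyInseparable F L] (P : (E.toAffine⁄L).Point) :
    ∃ Q : (E.toAffine⁄F).Point,
      Point.map (W' := E.toAffine) (IsScalarTower.toAlgHom K F L) Q = Module.finrank F L • P := by
  induction hd : Module.finrank F L using Nat.strong_induction_on generalizing L with
  | _ d ih =>
    subst hd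
    by_cases hs : Algebra.IsSeparable F L
    · refine exists_map_eq E _ _ fun x y _ _ ↦ ?_
      exact ⟨IsPurelyInseparable.surjective_algebraMap_of_isSeparable F L x,
        IsPurelyInseparable.surjective_algebraMap_of_isSeparable F L y⟩
    · obtain ⟨D, hD⟩ := exists_derivation_constants_ne_top F L hs
      obtain ⟨q, hq⟩ := ExpChar.exists F
      have : ExpChar D.constants q := expChar_of_injective_algebraMap (algebraMap F _).injective q
      have : ExpChar L q := expChar_of_injective_algebraMap (algebraMap F _).injective q
      obtain ⟨n, hn⟩ := IsPurelyInseparable.finrank_eq_pow (F := D.constants) L q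
      have h1 : Module.finrank D.constants L ≠ 1 := fun h ↦
        hD (IntermediateField.finrank_eq_one_iff_eq_top.mp h)
      have h0 : (Module.finrank D.constants L : L) = 0 := by
        have hn0 : n ≠ 0 := by rintro rfl; exact h1 (by rw [hn, pow_zero])
        -- Exponential characteristic 1 would force degree 1; otherwise the degree is a positive
        -- power of the characteristic.
        rcases ‹ExpChar L q› with _ | _
        · exact absurd (by rw [hn, one_pow]) h1
        · rw [hn, Nat.cast_pow, CharP.cast_eq_zero, zero_pow hn0]
      obtain ⟨Q, hQ⟩ := exists_map_constants E D h0 P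
      have hmul := Module.finrank_mul_finrank F D.constants L
      have hpos : 0 < Module.finrank D.constants L := Module.finrank_pos
      have hlt : Module.finrank F D.constants < Module.finrank F L := by
        rw [← hmul]
        exact lt_mul_of_one_lt_right Module.finrank_pos (by omega)
      obtain ⟨R, hR⟩ := ih _ hlt Q rfl
      have hR' : Point.map (W' := E.toAffine) (IsScalarTower.toAlgHom K F D.constants) R =
        Module.finrank F D.constants • Q := by convert hR
      refine ⟨R, ?_⟩
      rw [← hmul, mul_nsmul', ← hQ, ← map_nsmul, ← hR', map_map]
      rfl

end WeierstrassCurve.Affine.Point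

/-! ### Separable descent -/

namespace WeierstrassCurve.Affine.Point

variable {K : Type*} [Field K] (E : WeierstrassCurve K)

/-- Galois descent for points. -/
lemma exists_map_eq_of_forall_galois {N : Type*} [Field N] [Algebra K N] [IsGalois K N]
    [FiniteDimensional K N] (P : (E.toAffine⁄N).Point)
    (h : ∀ σ : N ≃ₐ[K] N, Point.map (W' := E.toAffine) (σ : N →ₐ[K] N) P = P) :
    ∃ Q : (E.toAffine⁄K).Point, Point.map (W' := E.toAffine) (Algebra.ofId K N) Q = P := by
  refine exists_map_eq E _ _ fun x y hxy hP ↦ ?_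
  subst hP
  have hσ (σ : N ≃ₐ[K] N) : σ x = x ∧ σ y = y := by
    exact some.inj (h σ)
  exact ⟨(IsGalois.mem_range_algebraMap_iff_fixed x).mpr fun σ ↦ (hσ σ).1,
    (IsGalois.mem_range_algebraMap_iff_fixed y).mpr fun σ ↦ (hσ σ).2⟩

/-- The sum of the conjugates of a point in a finite Galois extension is rational. -/
lemma exists_map_eq_sum_of_isGalois {F N : Type*} [Field F] [Algebra K F] [FiniteDimensional K F]
    [Field N] [Algebra K N] [IsGalois K N] [FiniteDimensional K N] (Q : (E.toAffine⁄F).Point) :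
    ∃ T : (E.toAffine⁄K).Point, Point.map (W' := E.toAffine) (Algebra.ofId K N) T =
      ∑ j : F →ₐ[K] N, Point.map (W' := E.toAffine) j Q := by
  refine exists_map_eq_of_forall_galois E _ fun σ ↦ ?_
  rw [map_sum]
  simp only [map_map]
  refine Fintype.sum_equiv ⟨fun j ↦ (σ : N →ₐ[K] N).comp j,
    fun j ↦ (σ.symm : N →ₐ[K] N).comp j, fun j ↦ ?_, fun j ↦ ?_⟩ _ _ fun j ↦ rfl
  · ext; simp
  · ext; simp

lemma exists_map_eq_sum_of_bijective_comp {F N Ω : Type*} [Field F] [Algebra K F]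
    [FiniteDimensional K F] [Field N] [Algebra K N] [IsGalois K N] [FiniteDimensional K N]
    [Field Ω] [Algebra K Ω] (f : N →ₐ[K] Ω)
    (hf : Function.Bijective fun j : F →ₐ[K] N ↦ f.comp j) (Q : (E.toAffine⁄F).Point) :
    ∃ T : (E.toAffine⁄K).Point, Point.map (W' := E.toAffine) (Algebra.ofId K Ω) T =
      ∑ j : F →ₐ[K] Ω, Point.map (W' := E.toAffine) j Q := by
  obtain ⟨T, hT⟩ := exists_map_eq_sum_of_isGalois E (N := N) Q
  refine ⟨T, ?_⟩
  rw [Subsingleton.elim (Algebra.ofId K Ω) (f.comp (Algebra.ofId K N)), ← map_map, hT, map_sum]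
  exact Fintype.sum_bijective _ hf _ _ fun j ↦ map_map j f Q

/-- The trace of a point exists for a finite separable extension. -/
lemma exists_map_eq_sum_of_isSeparable {F : Type*} [Field F] [Algebra K F] [FiniteDimensional K F]
    [Algebra.IsSeparable K F] (Ω : Type*) [Field Ω] [IsAlgClosed Ω] [Algebra K Ω]
    (Q : (E.toAffine⁄F).Point) :
    ∃ T : (E.toAffine⁄K).Point, Point.map (W' := E.toAffine) (Algebra.ofId K Ω) T =
      ∑ j : F →ₐ[K] Ω, Point.map (W' := E.toAffine) j Q := by
  -- All embeddings of F into Ω land in N, which their images generate; so N is Galois over K.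
  let N := IntermediateField.normalClosure K F Ω
  have : Normal K N :=
    (Algebra.IsAlgebraic.isNormalClosure_normalClosure fun x ↦ IsAlgClosed.splits _).normal
  have : Algebra.IsSeparable K N := by
    rw [← le_separableClosure_iff, normalClosure_le_iff]
    rintro f _ ⟨x, rfl⟩
    exact mem_separableClosure_iff.mpr <| (Algebra.IsSeparable.isSeparable K x).map f f.injective
  have : IsGalois K N := ⟨⟩
  exact exists_map_eq_sum_of_bijective_comp E N.val (normalClosure.algHomEquiv K F Ω).bijective Q

end WeierstrassCurve.Affine.Point

/-! ### Existence, uniqueness and towers -/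

section

variable {K : Type*} [Field K] (E : WeierstrassCurve K)

/-- Combines both descents: embeddings of L restrict bijectively to F, since L/F is purely
inseparable. -/
lemma exists_map_eq_finrank_nsmul_sum {F L : Type*} [Field F] [Field L] [Algebra K F] [Algebra K L]
    [Algebra F L] [IsScalarTower K F L] [FiniteDimensional K F] [FiniteDimensional K L]
    [FiniteDimensional F L] [Algebra.IsSeparable K F] [IsPurelyInseparable F L]
    (Ω : Type*) [Field Ω] [IsAlgClosed Ω] [Algebra K Ω] (P : (E.toAffine⁄L).Point) :
    ∃ T : (E.toAffine⁄K).Point, Point.map (W' := E.toAffine) (Algebra.ofId K Ω) T =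
      Module.finrank F L • ∑ j : L →ₐ[K] Ω, Point.map (W' := E.toAffine) j P := by
  obtain ⟨Q, hQ⟩ := Point.exists_map_eq_finrank_nsmul E (F := F) P
  obtain ⟨T, hT⟩ := Point.exists_map_eq_sum_of_isSeparable E Ω Q
  refine ⟨T, hT.trans ?_⟩
  rw [Finset.smul_sum]
  refine (Fintype.sum_bijective _
    (IsPurelyInseparable.bijective_restrictDomain F L K Ω) _ _ fun j ↦ ?_).symm
  rw [← map_nsmul, ← hQ, Point.map_map]
  rfl

/-- The defining equation of the trace has a solution. -/
theorem exists_isPointTrace {L : Type*} [Field L] [Algebra K L] [FiniteDimensional K L]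
    (Ω : Type*) [Field Ω] [IsAlgClosed Ω] [Algebra K Ω] (P : (E.toAffine⁄L).Point) :
    ∃ T, IsPointTrace E Ω P T :=
  exists_map_eq_finrank_nsmul_sum E (F := separableClosure K L) Ω P

theorem IsPointTrace.unique {L : Type*} [Field L] [Algebra K L] [FiniteDimensional K L]
    {Ω : Type*} [Field Ω] [Algebra K Ω] {P : (E.toAffine⁄L).Point} {T T' : (E.toAffine⁄K).Point}
    (h : IsPointTrace E Ω P T) (h' : IsPointTrace E Ω P T') : T = T' :=
  Point.map_injective _ (h.trans h'.symm)

lemma AlgHom.comp_bijective_of_isAlgClosed {L Ω Ω' : Type*} [Field L] [Algebra K L]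
    [FiniteDimensional K L] [Field Ω] [Algebra K Ω] [IsAlgClosed Ω] [Field Ω'] [Algebra K Ω']
    [IsAlgClosed Ω'] (f : Ω →ₐ[K] Ω') :
    Function.Bijective fun j : L →ₐ[K] Ω ↦ f.comp j := by
  rw [Fintype.bijective_iff_injective_and_card]
  refine ⟨fun j j' h ↦ AlgHom.ext fun x ↦ f.injective (DFunLike.congr_fun h x), ?_⟩
  rw [← Nat.card_eq_fintype_card, ← Nat.card_eq_fintype_card,
    ← Field.finSepDegree_eq_of_isAlgClosed K L Ω, Field.finSepDegree_eq_of_isAlgClosed K L Ω']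

/-- The trace does not depend on the algebraically closed field. -/
theorem isPointTrace_iff_of_algHom {L Ω Ω' : Type*} [Field L] [Algebra K L]
    [FiniteDimensional K L] [Field Ω] [Algebra K Ω] [IsAlgClosed Ω] [Field Ω'] [Algebra K Ω']
    [IsAlgClosed Ω'] (f : Ω →ₐ[K] Ω') (P : (E.toAffine⁄L).Point) (T : (E.toAffine⁄K).Point) :
    IsPointTrace E Ω' P T ↔ IsPointTrace E Ω P T := by
  rw [IsPointTrace, IsPointTrace, ← (Point.map_injective (W' := E.toAffine) f).eq_iff,
    map_nsmul, map_sum, Point.map_map,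
    Subsingleton.elim (f.comp (Algebra.ofId K Ω)) (Algebra.ofId K Ω'),
    Fintype.sum_bijective _ (AlgHom.comp_bijective_of_isAlgClosed f) _
      (fun j : L →ₐ[K] Ω' ↦ Point.map (W' := E.toAffine) j P) fun j ↦ Point.map_map j f P]

theorem isPointTrace_pointTrace {L : Type*} [Field L] [Algebra K L] [FiniteDimensional K L]
    (P : (E.toAffine⁄L).Point) : IsPointTrace E (AlgebraicClosure K) P (pointTrace E P) :=
  Classical.epsilon_spec (exists_isPointTrace E _ P)

theorem isPointTrace_iff_eq_pointTrace {L : Type*} [Field L] [Algebra K L] [FiniteDimensional K L]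
    (Ω : Type*) [Field Ω] [IsAlgClosed Ω] [Algebra K Ω] (P : (E.toAffine⁄L).Point)
    (T : (E.toAffine⁄K).Point) : IsPointTrace E Ω P T ↔ T = pointTrace E P := by
  rw [isPointTrace_iff_of_algHom E (IsAlgClosed.lift : AlgebraicClosure K →ₐ[K] Ω)]
  exact ⟨fun h ↦ h.unique E (isPointTrace_pointTrace E P), fun h ↦ h ▸ isPointTrace_pointTrace E P⟩

theorem sum_map_baseChange {L M : Type*} [Field L] [Field M] [Algebra K L] [Algebra L M]
    [Algebra K M] [IsScalarTower K L M] [FiniteDimensional K L] [FiniteDimensional K M]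
    [FiniteDimensional L M] (Ω : Type*) [Field Ω] [IsAlgClosed Ω] [Algebra K Ω]
    (P : (E.toAffine⁄L).Point) :
    ∑ j : M →ₐ[K] Ω, Point.map (W' := E.toAffine) j (Point.baseChange (W' := E.toAffine) L M P) =
      Field.finSepDegree L M • ∑ j : L →ₐ[K] Ω, Point.map (W' := E.toAffine) j P := by
  rw [Finset.smul_sum, ← Finset.sum_fiberwise Finset.univ (fun j : M →ₐ[K] Ω ↦ j.domRestrict L)]
  refine Finset.sum_congr rfl fun j _ ↦ ?_
  rw [Finset.sum_congr rfl (g := fun _ ↦ Point.map (W' := E.toAffine) j P), Finset.sum_const]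
  · congr 1
    -- With Ω an L-algebra through j, the fibre over j is the set of L-embeddings of M, of size
    -- [M:L]_s.
    let _ := j.toRingHom.toAlgebra
    have : IsScalarTower K L Ω := .of_algebraMap_eq fun x ↦ (j.commutes x).symm
    rw [Field.finSepDegree_eq_of_isAlgClosed L M Ω, ← Fintype.card_subtype,
      ← Nat.card_eq_fintype_card]
    exact Nat.card_congr
      { toFun := fun g ↦ { g.1 with commutes' := DFunLike.congr_fun g.2 }
        invFun := fun g ↦ ⟨g.restrictScalars K, AlgHom.ext g.commutes⟩
        left_inv := fun g ↦ rfl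
        right_inv := fun g ↦ rfl }
  · intro i hi
    rw [← (Finset.mem_filter.mp hi).2]
    cases P <;> rfl

end

/-- For `K ⊆ L ⊆ M` finite and `P ∈ E(L)`, `Tr^M_K P = [M:L] Tr^L_K P`, and both traces are
well defined. -/
theorem corollary1 {K L M : Type*} [Field K] [Field L] [Field M]
    [Algebra K L] [Algebra L M] [Algebra K M] [IsScalarTower K L M]
    [FiniteDimensional K L] [FiniteDimensional K M]
    (E : WeierstrassCurve K) [E.IsElliptic] (P : (E.toAffine⁄L).Point)
    (Ω : Type*) [Field Ω] [IsAlgClosed Ω] [Algebra K Ω] :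
    (∀ T : (E.toAffine⁄K).Point, IsPointTrace E Ω P T ↔ T = pointTrace E P) ∧
    (∀ T : (E.toAffine⁄K).Point,
      IsPointTrace E Ω (Point.baseChange (W' := E.toAffine) L M P) T ↔
        T = pointTrace E (Point.baseChange (W' := E.toAffine) L M P)) ∧
    pointTrace E (Point.baseChange (W' := E.toAffine) L M P) =
      Module.finrank L M • pointTrace E P := by
  have : FiniteDimensional L M := FiniteDimensional.right K L M
  refine ⟨isPointTrace_iff_eq_pointTrace E Ω P, isPointTrace_iff_eq_pointTrace E Ω _, ?_⟩
  refine ((isPointTrace_iff_eq_pointTrace E (AlgebraicClosure K) _ _).mp ?_).symm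
  have h := isPointTrace_pointTrace E P
  rw [IsPointTrace] at h ⊢
  rw [sum_map_baseChange, map_nsmul, h,
    ← Field.finInsepDegree_mul_finInsepDegree_of_isAlgebraic K L M,
    ← Field.finSepDegree_mul_finInsepDegree L M]
  simp only [← mul_nsmul']
  ring_nf
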